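/- Let $\mathcal C$ be a unitary premodular category, i.e. a unitary spherical fusion category over $\mathbb C$ (a semisimple rigid $\mathbb C$-linear monoidal category with finitely many simple objects, simple unit, and a positive dagger $\dagger$ compatible with the monoidal structure, the duals and the spherical structure) with a unitary braiding $\sigma$ whose twists $\theta_X$ (the right partial trace of $\sigma_{X,X}$) satisfy the ribbon equation $\theta_{X\otimes Y}=(\theta_X\otimes\theta_Y)B_{X,Y}$, where $B_{X,Y}=\sigma_{Y,X}\sigma_{X,Y}$ is the double braiding. Write $a,b,c,\dots$ for representatives of the isomorphism classes of simple objects, $N_{ab}^c=\dim\mathcal C(a\otimes b,c)$, let $(d_a)$ be the quantum dimensions, i.e. the unique positive solution of $d_ad_b=\sum_cN_{ab}^cd_c$, and let $\mathcal D=\big(\sum_c d_c^2\big)^{1/2}$ be the total quantum dimension. For an object $X$ let $\eta_X:1\to X\otimes\bar X$ be the cup of the spherical structure, and for simple $a,b$ let $$L_{a,b}=(\mathrm{id}_{a\otimes\bar a}\otimes\eta_b^\dagger)\,(\mathrm{id}_a\otimes B_{\bar a,b}\otimes\mathrm{id}_{\bar b})\,(\eta_a\otimes\mathrm{id}_{b\otimes\bar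 b}):\; b\otimes\bar b\to a\otimes\bar a$$ (associators and unitors suppressed). For each simple $c$ the connected (punctured) $S$-matrix $\mathcal S_c$ is the linear operator on the fusion space $\bigoplus_b\mathcal C(c,b\otimes\bar b)$ given by $$\mathcal S_c\,\beta=\frac{\sqrt{d_c}}{\mathcal D}\sum_a d_a\,L_{a,b}\circ\beta\qquad(\beta\in\mathcal C(c,b\otimes\bar b)),$$ regarded as a matrix with respect to bases of the spaces $\mathcal C(c,b\otimes\bar b)$ normalized by $\nu^\dagger\mu=\delta_{\mu\nu}\sqrt{d_bd_{\bar b}/d_c}\;\mathrm{id}_c$ (where $d_{\bar b}=d_b$). Then, for any such choice of bases, $$\sum_{c}\operatorname{Tr}\big(\mathcal S_c^\dagger\mathcal S_c\big)=\mathcal D^2,$$ the sum running over all isomorphism classes of simple objects $c$. -/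

import Mathlib

open CategoryTheory MonoidalCategory Limits

universe v u

/-- A dagger on a category: an involutive contravariant identity-on-objects functor. -/
class DaggerCategory (C : Type u) [Category.{v} C] where
  /-- the adjoint `f† : Y ⟶ X` of `f : X ⟶ Y` -/
  dagger : ∀ {X Y : C}, (X ⟶ Y) → (Y ⟶ X)
  dagger_id : ∀ X : C, dagger (𝟙 X) = 𝟙 X
  dagger_comp : ∀ {X Y Z : C} (f : X ⟶ Y) (g : Y ⟶ Z), dagger (f ≫ g) = dagger g ≫ dagger f
  dagger_dagger : ∀ {X Y : C} (f : X ⟶ Y), dagger (dagger f) = f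

postfix:max "†" => DaggerCategory.dagger

/-- A fusion category over `ℂ`: a `ℂ`-linear abelian rigid monoidal category with bilinear tensor
product, finite dimensional morphism spaces and simple unit, in which every object is a finite
direct sum of simple objects and there are finitely many simple objects up to isomorphism.
(Only right duals are listed; under a dagger compatible with the tensor product they are left
duals too.) -/
class FusionCategory (C : Type u) [Category.{v} C] [Abelian C] [Linear ℂ C] [MonoidalCategory C]
    [MonoidalPreadditive C] [MonoidalLinear ℂ C] [RightRigidCategory C] : Prop where
  finiteDimensional_hom : ∀ X Y : C, FiniteDimensional ℂ (X ⟶ Y)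
  simple_unit : Simple (𝟙_ C)
  semisimple : ∀ X : C, ∃ (n : ℕ) (S : Fin n → C) (b : Bicone S),
    (∀ i, Simple (S i)) ∧ Nonempty b.IsBilimit ∧ Nonempty (X ≅ b.pt)
  finite_simples : ∃ (n : ℕ) (S : Fin n → C), ∀ X : C, Simple X → ∃ i, Nonempty (X ≅ S i)

/-- A unitary spherical fusion category: a fusion category with a positive (`C⋆`) dagger for which
the tensor product is a dagger functor and the structure isomorphisms are unitary, and whose
chosen duals, with cup `1 ⟶ X ⊗ Xᘁ` and cap `Xᘁ ⊗ X ⟶ 1`, are compatible with the dagger and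
spherical. -/
class UnitaryFusionCategory (C : Type u) [Category.{v} C] [Abelian C] [Linear ℂ C]
    [MonoidalCategory C] [MonoidalPreadditive C] [MonoidalLinear ℂ C] [RightRigidCategory C]
    extends DaggerCategory C, FusionCategory C where
  dagger_add : ∀ {X Y : C} (f g : X ⟶ Y), (f + g)† = f† + g†
  dagger_smul : ∀ {X Y : C} (z : ℂ) (f : X ⟶ Y), (z • f)† = (starRingEnd ℂ z) • f†
  eq_zero_of_comp_dagger : ∀ {X Y : C} (f : X ⟶ Y), f ≫ f† = 0 → f = 0
  comp_dagger_positive : ∀ {X Y : C} (f : X ⟶ Y), ∃ g : X ⟶ X, f ≫ f† = g ≫ g†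
  dagger_tensorHom : ∀ {X₁ Y₁ X₂ Y₂ : C} (f : X₁ ⟶ Y₁) (g : X₂ ⟶ Y₂),
    (f ⊗ₘ g)† = f† ⊗ₘ g†
  dagger_associator : ∀ X Y Z : C, (α_ X Y Z).hom† = (α_ X Y Z).inv
  dagger_leftUnitor : ∀ X : C, (λ_ X).hom† = (λ_ X).inv
  dagger_rightUnitor : ∀ X : C, (ρ_ X).hom† = (ρ_ X).inv
  /-- taking duals commutes with the dagger -/
  dagger_dual : ∀ {X Y : C} (f : X ⟶ Y), (fᘁ)† = (f†)ᘁ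
  /-- the loop closing `f` on the right equals the loop closing `f` on the left -/
  spherical : ∀ {X : C} (f : X ⟶ X),
    η_ X Xᘁ ≫ (f ▷ Xᘁ) ≫ (η_ X Xᘁ)† = (ε_ X Xᘁ)† ≫ (Xᘁ ◁ f) ≫ ε_ X Xᘁ

section Diagrams

variable {C : Type u} [Category.{v} C] [MonoidalCategory C] [RightRigidCategory C]
  [BraidedCategory C] [DaggerCategory C]

/-- The double braiding `B_{X,Y}`. -/
def doubleBraiding (X Y : C) : X ⊗ Y ⟶ X ⊗ Y :=
  (β_ X Y).hom ≫ (β_ Y X).hom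

/-- The cap `X ⊗ Xᘁ ⟶ 1`, adjoint to the cup `1 ⟶ X ⊗ Xᘁ`. -/
def cap (X : C) : X ⊗ Xᘁ ⟶ 𝟙_ C :=
  (η_ X Xᘁ)†

/-- The twist `θ_X`: the braiding of `X` with itself, with the right hand strand closed up. -/
def twist (X : C) : X ⟶ X :=
  (ρ_ X).inv ≫ (X ◁ η_ X Xᘁ) ≫ (α_ X X Xᘁ).inv ≫ ((β_ X X).hom ▷ Xᘁ) ≫ (α_ X X Xᘁ).hom ≫
    (X ◁ cap X) ≫ (ρ_ X).hom

/-- The link diagram `Y ⊗ Yᘁ ⟶ X ⊗ Xᘁ`: create a pair `X ⊗ Xᘁ` by a cup to the left of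
`Y ⊗ Yᘁ`, pass the strand `Xᘁ` once around the strand `Y`, and close `Y ⊗ Yᘁ` by a cap. -/
def link (X Y : C) : Y ⊗ Yᘁ ⟶ X ⊗ Xᘁ :=
  (λ_ (Y ⊗ Yᘁ)).inv ≫ (η_ X Xᘁ ▷ (Y ⊗ Yᘁ)) ≫ (α_ X Xᘁ (Y ⊗ Yᘁ)).hom ≫
    (X ◁ ((α_ Xᘁ Y Yᘁ).inv ≫ (doubleBraiding Xᘁ Y ▷ Yᘁ) ≫ (α_ Xᘁ Y Yᘁ).hom ≫
      (Xᘁ ◁ cap Y) ≫ (ρ_ Xᘁ).hom))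

end Diagrams

/-- A unitary premodular category: a unitary spherical fusion category with a unitary braiding
whose twists satisfy the ribbon equation. -/
class UnitaryPremodularCategory (C : Type u) [Category.{v} C] [Abelian C] [Linear ℂ C]
    [MonoidalCategory C] [MonoidalPreadditive C] [MonoidalLinear ℂ C] [RightRigidCategory C]
    [BraidedCategory C] extends UnitaryFusionCategory C where
  dagger_braiding : ∀ X Y : C, (β_ X Y).hom† = (β_ X Y).inv
  ribbon : ∀ X Y : C, twist (X ⊗ Y) = doubleBraiding X Y ≫ (twist X ⊗ₘ twist Y)

/-- `s` lists the simple objects, each isomorphism class exactly once. -/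
structure IsSimpleObjects {C : Type u} [Category.{v} C] [HasZeroMorphisms C] {ι : Type*}
    (s : ι → C) : Prop where
  simple : ∀ i, Simple (s i)
  eq_of_iso : ∀ i j, Nonempty (s i ≅ s j) → i = j
  complete : ∀ X : C, Simple X → ∃ i, Nonempty (X ≅ s i)

/-- The fusion rule `N_{ab}^c`, the dimension of the space of morphisms `a ⊗ b ⟶ c`. -/
noncomputable def fusionRule {C : Type u} [Category.{v} C] [Preadditive C] [Linear ℂ C]
    [MonoidalCategory C] (a b c : C) : ℕ :=
  Module.finrank ℂ (a ⊗ b ⟶ c)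

/-- `d` is the family of quantum dimensions of the simple objects: the (unique) positive solution
of `d_a d_b = ∑_c N_{ab}^c d_c`. -/
structure IsQuantumDimension {C : Type u} [Category.{v} C] [Preadditive C] [Linear ℂ C]
    [MonoidalCategory C] {ι : Type*} [Fintype ι] (s : ι → C) (d : ι → ℝ) : Prop where
  pos : ∀ a, 0 < d a
  mul_eq : ∀ a b, d a * d b = ∑ c, (fusionRule (s a) (s b) (s c) : ℝ) * d c

/-- The total quantum dimension `𝒟`, the positive square root of `∑_c d_c²`. -/
noncomputable def totalDim {ι : Type*} [Fintype ι] (d : ι → ℝ) : ℝ :=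
  Real.sqrt (∑ c, d c ^ 2)

section ConnectedS

variable {C : Type u} [Category.{v} C] [Preadditive C] [Linear ℂ C] [MonoidalCategory C]
  [RightRigidCategory C] [DaggerCategory C] {ι : Type*}

/-- The fusion space on which `S_c` acts: the direct sum over simple `b` of the spaces of
trivalent vertices `c ⟶ b ⊗ bᘁ`. -/
abbrev FusionSpace (s : ι → C) (c : ι) : Type _ :=
  ∀ b : ι, (s c ⟶ s b ⊗ (s b)ᘁ)

/-- The connected `S`-matrix as an operator: a vertex `β : c ⟶ b ⊗ bᘁ` is sent to
`(√d_c / 𝒟) ∑_a d_a (link_{a,b} ∘ β)`, extended linearly in `β` and over `b`. -/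
noncomputable def connectedS [BraidedCategory C] [Fintype ι] (s : ι → C) (d : ι → ℝ) (c : ι) :
    FusionSpace s c →ₗ[ℂ] FusionSpace s c :=
  LinearMap.pi fun a => ((Real.sqrt (d c) / totalDim d * d a : ℝ) : ℂ) •
    ∑ b, (Linear.rightComp ℂ (s c) (link (s a) (s b))).comp (LinearMap.proj b)

/-- Bases of trivalent vertices `c ⟶ b ⊗ bᘁ`, normalized by
`μ ≫ ν† = δ_{μν} √(d_b d_b / d_c) 𝟙_c`. -/
def IsNormalizedVertexBasis {κ : ι → ι → Type*} (s : ι → C) (d : ι → ℝ)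
    (e : ∀ c b, Module.Basis (κ c b) ℂ (s c ⟶ s b ⊗ (s b)ᘁ)) : Prop :=
  (∀ c b μ, e c b μ ≫ (e c b μ)† = ((Real.sqrt (d b * d b / d c) : ℝ) : ℂ) • 𝟙 (s c)) ∧
  (∀ c b μ ν, μ ≠ ν → e c b μ ≫ (e c b ν)† = 0)

/-- The matrix of `S_c` in a basis of trivalent vertices; its indices are pairs `(b, β)`. -/
noncomputable def connectedSMatrix [BraidedCategory C] [Fintype ι] [DecidableEq ι]
    {κ : ι → ι → Type*} [∀ c b, Fintype (κ c b)] [∀ c b, DecidableEq (κ c b)]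
    (s : ι → C) (d : ι → ℝ) (e : ∀ c b, Module.Basis (κ c b) ℂ (s c ⟶ s b ⊗ (s b)ᘁ)) (c : ι) :
    Matrix ((b : ι) × κ c b) ((b : ι) × κ c b) ℂ :=
  LinearMap.toMatrix (Pi.basis (e c)) (Pi.basis (e c)) (connectedS s d c)

end ConnectedS

/-! ### Mates of morphisms with respect to arbitrary exact pairings. -/

section Mates

variable {C : Type u} [Category.{v} C] [MonoidalCategory C]

/-! Fix `a`, `b` and write `L` for the link diagram. The trace of `L ≫ L†` can be computed in two
ways. Bending the incoming strands of `L` upwards leaves the double braiding between two nested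
cups; the double braiding is unitary, so it cancels against its dagger and two loops remain, with
value `d_a d_b` (`rightTrace_link_comp_dagger`). On the other hand, resolving the identity of `b ⊗
b̄` into trivalent vertices (`sum_dagger_comp_eq_id`) and rotating each vertex around the trace
gives `d_a / d_b` times the sum over `c` of `d_c` times the squared matrix elements of `L`. Hence
that sum is `d_b ^ 2` (`sum_normSq_repr_link`). The prefactors of `S_c` weight it by `d_a ^ 2 / 𝒟 ^
2`, and summing over `a` and `b` gives `𝒟 ^ 2`.

Two facts support this: the trace is cyclic, also on tensor products with their composite duals
(`rightTrace_comp_dagger_eq`, `IsSpherical.tensor`), and the numbers `d`, given only by the fusion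
equations, are the values of the loops (`IsQuantumDimension.loop_eq`). -/

theorem exists_rightMate {X X' Y Y' : C} [ExactPairing X X'] [ExactPairing Y Y'] (f : X ⟶ Y) :
    ∃ g : Y' ⟶ X', η_ Y Y' ≫ Y ◁ g = η_ X X' ≫ f ▷ X' ∧
      g ▷ X ≫ ε_ X X' = Y' ◁ f ≫ ε_ Y Y' :=
  letI : HasRightDual X := ⟨X'⟩
  letI : HasRightDual Y := ⟨Y'⟩
  ⟨rightAdjointMate f, coevaluation_comp_rightAdjointMate f, rightAdjointMate_comp_evaluation f⟩

theorem exists_leftMate {X X' Y Y' : C} [ExactPairing X X'] [ExactPairing Y Y'] (g : Y' ⟶ X') :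
    ∃ f : X ⟶ Y, η_ Y Y' ≫ Y ◁ g = η_ X X' ≫ f ▷ X' ∧
      g ▷ X ≫ ε_ X X' = Y' ◁ f ≫ ε_ Y Y' :=
  letI : HasLeftDual X' := ⟨X⟩
  letI : HasLeftDual Y' := ⟨Y⟩
  ⟨leftAdjointMate g, (coevaluation_comp_leftAdjointMate g).symm,
    (leftAdjointMate_comp_evaluation g).symm⟩

end Mates

section Preadditive

variable {C : Type u} [Category.{v} C] [Preadditive C] [MonoidalCategory C] [MonoidalPreadditive C]

theorem whiskerLeft_sub (X : C) {Y Z : C} (f g : Y ⟶ Z) : X ◁ (f - g) = X ◁ f - X ◁ g :=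
  (tensoringLeft C |>.obj X).map_sub

theorem sub_whiskerRight {Y Z : C} (f g : Y ⟶ Z) (X : C) : (f - g) ▷ X = f ▷ X - g ▷ X :=
  (tensoringRight C |>.obj X).map_sub

end Preadditive

/-! ### Dagger calculus, spherical dual pairs and cyclicity of the trace. -/

section Pairings

variable {C : Type u} [Category.{v} C] [Abelian C] [Linear ℂ C] [MonoidalCategory C]
  [MonoidalPreadditive C] [MonoidalLinear ℂ C] [RightRigidCategory C] [UnitaryFusionCategory C]

open DaggerCategory UnitaryFusionCategory

attribute [simp] dagger_id dagger_dagger dagger_associator dagger_leftUnitor dagger_rightUnitor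

@[simp]
theorem dagger_associator_inv (X Y Z : C) : (α_ X Y Z).inv† = (α_ X Y Z).hom := by
  rw [← dagger_associator, dagger_dagger]

@[simp]
theorem dagger_leftUnitor_inv (X : C) : (λ_ X).inv† = (λ_ X).hom := by
  rw [← dagger_leftUnitor, dagger_dagger]

@[simp]
theorem dagger_rightUnitor_inv (X : C) : (ρ_ X).inv† = (ρ_ X).hom := by
  rw [← dagger_rightUnitor, dagger_dagger]

@[simp]
theorem dagger_whiskerLeft (X : C) {Y Z : C} (f : Y ⟶ Z) : (X ◁ f)† = X ◁ f† := by
  rw [← id_tensorHom, dagger_tensorHom, dagger_id, id_tensorHom]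

@[simp]
theorem dagger_whiskerRight {Y Z : C} (f : Y ⟶ Z) (X : C) : (f ▷ X)† = f† ▷ X := by
  rw [← tensorHom_id, dagger_tensorHom, dagger_id, tensorHom_id]

theorem dagger_neg {X Y : C} (f : X ⟶ Y) : (-f)† = -f† := by
  have := dagger_smul (-1 : ℂ) f
  simpa using this

theorem dagger_sub {X Y : C} (f g : X ⟶ Y) : (f - g)† = f† - g† := by
  rw [sub_eq_add_neg, dagger_add, dagger_neg, ← sub_eq_add_neg]

theorem dagger_zero {X Y : C} : (0 : X ⟶ Y)† = 0 := by
  simpa using dagger_sub (0 : X ⟶ Y) 0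

/-- The norm square of a state `1 ⟶ X` is a nonnegative number. -/
theorem exists_comp_dagger_eq_smul_id {X : C} (k : 𝟙_ C ⟶ X) :
    ∃ t : ℝ, 0 ≤ t ∧ k ≫ k† = (t : ℂ) • 𝟙 (𝟙_ C) := by
  have := FusionCategory.simple_unit (C := C)
  have := FusionCategory.finiteDimensional_hom (𝟙_ C) (𝟙_ C)
  obtain ⟨g, hg⟩ := comp_dagger_positive k
  obtain ⟨z, rfl⟩ := endomorphism_simple_eq_smul_id ℂ g
  refine ⟨Complex.normSq z, Complex.normSq_nonneg z, ?_⟩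
  rw [hg, dagger_smul, dagger_id, Linear.smul_comp, Linear.comp_smul, smul_smul,
    Category.comp_id, Complex.mul_conj]

theorem id_unit_ne_zero : 𝟙 (𝟙_ C) ≠ 0 := by
  have := FusionCategory.simple_unit (C := C)
  exact id_nonzero _

/-- The unit is simple, so both norm squares are nonnegative reals and cannot cancel each other. -/
theorem eq_zero_of_comp_dagger_add_eq_zero {X Y : C} (k : 𝟙_ C ⟶ X) (l : 𝟙_ C ⟶ Y)
    (h : k ≫ k† + l ≫ l† = 0) : k = 0 := by
  obtain ⟨t, ht, hk⟩ := exists_comp_dagger_eq_smul_id k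
  obtain ⟨r, hr, hl⟩ := exists_comp_dagger_eq_smul_id l
  rw [hk, hl, ← add_smul, smul_eq_zero, or_iff_left id_unit_ne_zero] at h
  have h0 : t + r = 0 := by exact_mod_cast h
  have ht0 : t = 0 := by linarith
  exact eq_zero_of_comp_dagger k (by simp [hk, ht0])

/-- The exact pairing obtained from `X, X'` by applying the dagger, which exchanges the roles of
the two objects. -/
@[reducible]
def ExactPairing.daggerSwap (X X' : C) [ExactPairing X X'] : ExactPairing X' X where
  coevaluation' := (ε_ X X')†
  evaluation' := (η_ X X')†
  coevaluation_evaluation' := by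
    have := congrArg dagger (ExactPairing.evaluation_coevaluation X X')
    simpa only [dagger_comp, dagger_whiskerLeft, dagger_whiskerRight, dagger_associator,
      dagger_leftUnitor, dagger_rightUnitor_inv, Category.assoc] using this
  evaluation_coevaluation' := by
    have := congrArg dagger (ExactPairing.coevaluation_evaluation X X')
    simpa only [dagger_comp, dagger_whiskerLeft, dagger_whiskerRight, dagger_associator_inv,
      dagger_rightUnitor, dagger_leftUnitor_inv, Category.assoc] using this

/-- A dual pair is spherical if closing an endomorphism on the right or on the left gives the
same loop. -/
class IsSpherical (X X' : C) [ExactPairing X X'] : Prop where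
  loop_eq : ∀ f : X ⟶ X,
    η_ X X' ≫ f ▷ X' ≫ (η_ X X')† = (ε_ X X')† ≫ X' ◁ f ≫ ε_ X X'

instance isSpherical_rightDual (X : C) : IsSpherical X Xᘁ := ⟨spherical⟩

/-- Closing an endomorphism on the right. -/
def rightTrace (X X' : C) [ExactPairing X X'] (f : X ⟶ X) : 𝟙_ C ⟶ 𝟙_ C :=
  η_ X X' ≫ f ▷ X' ≫ (η_ X X')†

theorem rightTrace_eq_left (X X' : C) [ExactPairing X X'] [IsSpherical X X'] (f : X ⟶ X) :
    rightTrace X X' f = (ε_ X X')† ≫ X' ◁ f ≫ ε_ X X' :=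
  IsSpherical.loop_eq f

/-- Every endomorphism of `X'` is the mate of one of `X`; sliding it through the cup and the cap
reduces the claim to sphericality for `X`. -/
theorem rightTrace_whiskerLeft_eq (X X' : C) [ExactPairing X X'] [IsSpherical X X']
    (h : X' ⟶ X') : η_ X X' ≫ X ◁ h ≫ (η_ X X')† = (ε_ X X')† ≫ h ▷ X ≫ ε_ X X' := by
  obtain ⟨k, hk, hk'⟩ := exists_leftMate (X := X) (Y := X) h
  rw [hk', reassoc_of% hk]
  exact IsSpherical.loop_eq k

/-- The dual object inherits sphericality. -/
theorem IsSpherical.daggerSwap (X X' : C) [ExactPairing X X'] [IsSpherical X X'] :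
    letI := ExactPairing.daggerSwap X X'
    IsSpherical X' X := by
  let _ := ExactPairing.daggerSwap X X'
  refine ⟨fun h => ?_⟩
  change (ε_ X X')† ≫ h ▷ X ≫ (ε_ X X')†† = (η_ X X')†† ≫ X ◁ h ≫ (η_ X X')†
  rw [dagger_dagger, dagger_dagger]
  exact (rightTrace_whiskerLeft_eq X X' h).symm

/-- Cyclicity would follow if mates commuted with the dagger. `dagger_dual` asserts this for the
chosen duals only; for arbitrary spherical pairs it is extracted here from positivity. -/
theorem rightTrace_comp_dagger_eq {X X' Y Y' : C} [ExactPairing X X'] [ExactPairing Y Y']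
    [IsSpherical X X'] [IsSpherical Y Y'] (f g : X ⟶ Y) :
    rightTrace X X' (f ≫ g†) = rightTrace Y Y' (g† ≫ f) := by
  -- `a f` is the mate of `f` and `b f` the mate of `f†`; the aim is to replace `(a g)†` by `b g`
  -- under the cap.
  have A (f : X ⟶ Y) := exists_rightMate (X' := X') (Y' := Y') f
  have B (f : X ⟶ Y) := exists_rightMate (X' := Y') (Y' := X') (f†)
  choose a ha ha' using A
  choose b hb hb' using B
  have hb2 (f : X ⟶ Y) : X ◁ (b f)† ≫ (η_ X X')† = f ▷ Y' ≫ (η_ Y Y')† := by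
    simpa [dagger_comp] using congrArg dagger (hb f)
  have hb2' (f : X ⟶ Y) : (ε_ Y Y')† ≫ (b f)† ▷ Y = (ε_ X X')† ≫ X' ◁ f := by
    simpa [dagger_comp] using congrArg dagger (hb' f)
  have ha2 (f : X ⟶ Y) : Y ◁ (a f)† ≫ (η_ Y Y')† = f† ▷ X' ≫ (η_ X X')† := by
    simpa [dagger_comp] using congrArg dagger (ha f)
  have ha2' (f : X ⟶ Y) : (ε_ X X')† ≫ (a f)† ▷ X = (ε_ Y Y')† ≫ Y' ◁ f† := by
    simpa [dagger_comp] using congrArg dagger (ha' f)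
  have e1 (f g : X ⟶ Y) : η_ Y Y' ≫ Y ◁ a f ≫ Y ◁ (a g)† ≫ (η_ Y Y')† =
      rightTrace X X' (f ≫ g†) := by
    rw [ha2, reassoc_of% ha, rightTrace, comp_whiskerRight, Category.assoc]
  have e2 (f g : X ⟶ Y) : η_ Y Y' ≫ Y ◁ a f ≫ Y ◁ b g ≫ (η_ Y Y')† =
      rightTrace Y Y' (g† ≫ f) := by
    rw [reassoc_of% ha, ← whisker_exchange_assoc, reassoc_of% hb, rightTrace, comp_whiskerRight,
      Category.assoc]
  have e3 (f g : X ⟶ Y) : η_ Y Y' ≫ Y ◁ (b f)† ≫ Y ◁ (a g)† ≫ (η_ Y Y')† =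
      rightTrace Y Y' (g† ≫ f) := by
    rw [ha2, whisker_exchange_assoc, hb2, rightTrace, comp_whiskerRight, Category.assoc]
  have e4 (f g : X ⟶ Y) : η_ Y Y' ≫ Y ◁ (b f)† ≫ Y ◁ b g ≫ (η_ Y Y')† =
      rightTrace X X' (f ≫ g†) := by
    rw [← MonoidalCategory.whiskerLeft_comp_assoc, rightTrace_whiskerLeft_eq,
      comp_whiskerRight_assoc, reassoc_of% hb2', hb', rightTrace_eq_left,
      MonoidalCategory.whiskerLeft_comp, Category.assoc]
  have e1' (f g : X ⟶ Y) : (ε_ X X')† ≫ (a f)† ▷ X ≫ a g ▷ X ≫ ε_ X X' =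
      rightTrace Y Y' (f† ≫ g) := by
    rw [ha', reassoc_of% ha2', rightTrace_eq_left, MonoidalCategory.whiskerLeft_comp,
      Category.assoc]
  have e2' (f g : X ⟶ Y) : (ε_ X X')† ≫ b f ▷ X ≫ a g ▷ X ≫ ε_ X X' =
      rightTrace X X' (g ≫ f†) := by
    rw [ha', ← whisker_exchange_assoc, hb', rightTrace_eq_left, MonoidalCategory.whiskerLeft_comp,
      Category.assoc]
  have e3' (f g : X ⟶ Y) : (ε_ X X')† ≫ (a f)† ▷ X ≫ (b g)† ▷ X ≫ ε_ X X' =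
      rightTrace X X' (g ≫ f†) := by
    rw [reassoc_of% ha2', whisker_exchange_assoc, reassoc_of% hb2', rightTrace_eq_left,
      MonoidalCategory.whiskerLeft_comp, Category.assoc]
  have e4' (f g : X ⟶ Y) : (ε_ X X')† ≫ b f ▷ X ≫ (b g)† ▷ X ≫ ε_ X X' =
      rightTrace Y Y' (f† ≫ g) := by
    rw [← comp_whiskerRight_assoc, ← rightTrace_whiskerLeft_eq,
      MonoidalCategory.whiskerLeft_comp_assoc, reassoc_of% hb, hb2, rightTrace, comp_whiskerRight,
      Category.assoc]
  -- With `x` the trace of `f ≫ f†` and `y` that of `f† ≫ f`, the two norm squares are `2x - 2y` and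
  -- `2y - 2x`. Their sum is zero, so both vanish.
  have key (f : X ⟶ Y) : η_ Y Y' ≫ Y ◁ (a f - (b f)†) = 0 := by
    refine eq_zero_of_comp_dagger_add_eq_zero _ ((ε_ X X')† ≫ (a f - (b f)†)† ▷ X) ?_
    simp only [dagger_comp, dagger_whiskerLeft, dagger_whiskerRight, dagger_sub, dagger_dagger,
      whiskerLeft_sub, sub_whiskerRight,
      Preadditive.comp_sub, Preadditive.sub_comp, Category.assoc, e1, e2, e3, e4, e1', e2', e3',
      e4']
    abel
  have key' : Y ◁ (a g)† ≫ (η_ Y Y')† = Y ◁ b g ≫ (η_ Y Y')† := by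
    have := congrArg dagger (key g)
    simp only [dagger_comp, dagger_whiskerLeft, dagger_sub, dagger_dagger, dagger_zero,
      whiskerLeft_sub, Preadditive.sub_comp] at this
    exact sub_eq_zero.mp this
  rw [← e1, key', e2]

theorem dagger_tensor_coevaluation (X X' Y Y' : C) [ExactPairing X X'] [ExactPairing Y Y'] :
    (η_ (X ⊗ Y) (Y' ⊗ X'))† = 𝟙 _ ⊗≫ (X ◁ (η_ Y Y')†) ▷ X' ⊗≫ (η_ X X')† := by
  rw [ExactPairing.tensor_coevaluation]
  simp [monoidalComp, dagger_comp]

/-- The tensor product of spherical dual pairs is spherical. -/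
instance IsSpherical.tensor (X X' Y Y' : C) [ExactPairing X X'] [ExactPairing Y Y']
    [IsSpherical X X'] [IsSpherical Y Y'] : IsSpherical (X ⊗ Y) (Y' ⊗ X') := by
  refine ⟨fun f => ?_⟩
  have hε : (ε_ (X ⊗ Y) (Y' ⊗ X'))† =
      (ε_ Y Y')† ⊗≫ Y' ◁ ((ε_ X X')† ▷ Y) ⊗≫ 𝟙 _ := by
    rw [ExactPairing.tensor_evaluation]
    simp [monoidalComp, dagger_comp]
  -- `p` closes the `Y` strand of `f` on the right and `q` closes the `X` strand on the left; moving
  -- one strand at a time uses sphericality of `X`, then of `Y`.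
  let p : X ⟶ X := 𝟙 _ ⊗≫ X ◁ η_ Y Y' ⊗≫ f ▷ Y' ⊗≫ X ◁ (η_ Y Y')† ⊗≫ 𝟙 _
  let q : Y ⟶ Y := 𝟙 _ ⊗≫ (ε_ X X')† ▷ Y ⊗≫ X' ◁ f ⊗≫ ε_ X X' ▷ Y ⊗≫ 𝟙 _
  calc
    _ = η_ X X' ≫ p ▷ X' ≫ (η_ X X')† := by
      rw [dagger_tensor_coevaluation, ExactPairing.tensor_coevaluation]; dsimp only [p]; monoidal
    _ = (ε_ X X')† ≫ X' ◁ p ≫ ε_ X X' := IsSpherical.loop_eq p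
    _ = 𝟙 _ ⊗≫ ((ε_ X X')† ▷ 𝟙_ C ≫ (X' ⊗ X) ◁ η_ Y Y') ⊗≫ X' ◁ f ▷ Y' ⊗≫
        ((X' ⊗ X) ◁ (η_ Y Y')† ≫ ε_ X X' ▷ 𝟙_ C) ⊗≫ 𝟙 _ := by
      dsimp only [p]; monoidal
    _ = 𝟙 _ ⊗≫ (𝟙_ C ◁ η_ Y Y' ≫ (ε_ X X')† ▷ (Y ⊗ Y')) ⊗≫ X' ◁ f ▷ Y' ⊗≫
        (ε_ X X' ▷ (Y ⊗ Y') ≫ 𝟙_ C ◁ (η_ Y Y')†) ⊗≫ 𝟙 _ := by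
      rw [whisker_exchange, whisker_exchange]
    _ = η_ Y Y' ≫ q ▷ Y' ≫ (η_ Y Y')† := by dsimp only [q]; monoidal
    _ = (ε_ Y Y')† ≫ Y' ◁ q ≫ ε_ Y Y' := IsSpherical.loop_eq q
    _ = _ := by
      rw [hε, ExactPairing.tensor_evaluation]; dsimp only [q]; monoidal

end Pairings

/-! ### The link diagram and its Hilbert-Schmidt norm. -/

section Link

variable {C : Type u} [Category.{v} C] [Abelian C] [Linear ℂ C] [MonoidalCategory C]
  [MonoidalPreadditive C] [MonoidalLinear ℂ C] [RightRigidCategory C]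

open DaggerCategory UnitaryFusionCategory

theorem rightTrace_tensor_id [UnitaryFusionCategory C] (X X' Y Y' : C) [ExactPairing X X']
    [ExactPairing Y Y'] {t : ℂ} (h : η_ Y Y' ≫ (η_ Y Y')† = t • 𝟙 (𝟙_ C)) :
    rightTrace (X ⊗ Y) (Y' ⊗ X') (𝟙 _) = t • (η_ X X' ≫ (η_ X X')†) := by
  calc
    _ = η_ X X' ⊗≫ (X ◁ (η_ Y Y' ≫ (η_ Y Y')†)) ▷ X' ⊗≫ (η_ X X')† := by
      rw [rightTrace, dagger_tensor_coevaluation, ExactPairing.tensor_coevaluation]; monoidal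
    _ = _ := by
      rw [h]
      simp [monoidalComp]

variable [BraidedCategory C] [UnitaryPremodularCategory C]

open UnitaryPremodularCategory

theorem doubleBraiding_comp_dagger (X Y : C) :
    doubleBraiding X Y ≫ (doubleBraiding X Y)† = 𝟙 _ := by
  simp [doubleBraiding, dagger_comp, dagger_braiding]

/-- Bending the incoming strands of the link diagram upwards turns it into the double braiding
between two nested cups. -/
theorem coevaluation_comp_link (X Y : C) :
    (η_ Y Yᘁ ⊗≫ (Y ◁ (ε_ Y Yᘁ)†) ▷ Yᘁ ⊗≫ 𝟙 ((Y ⊗ Yᘁ) ⊗ Y ⊗ Yᘁ)) ≫ link X Y ▷ (Y ⊗ Yᘁ) =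
      η_ X Xᘁ ⊗≫ (X ⊗ Xᘁ) ◁ η_ Y Yᘁ ⊗≫ X ◁ doubleBraiding Xᘁ Y ▷ Yᘁ ⊗≫ 𝟙 _ := by
  -- The cap inside `link` straightens against the bending cup by the zigzag identity of the swapped
  -- pair.
  have snake : Y ◁ (ε_ Y Yᘁ)† ⊗≫ (η_ Y Yᘁ)† ▷ Y = ⊗𝟙.hom :=
    letI := ExactPairing.daggerSwap Y Yᘁ
    ExactPairing.coevaluation_evaluation'' Yᘁ Y
  set w : 𝟙_ C ⟶ (Y ⊗ Yᘁ) ⊗ Y ⊗ Yᘁ :=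
    η_ Y Yᘁ ⊗≫ (Y ◁ (ε_ Y Yᘁ)†) ▷ Yᘁ ⊗≫ 𝟙 ((Y ⊗ Yᘁ) ⊗ Y ⊗ Yᘁ) with hw
  set B := doubleBraiding Xᘁ Y with hB
  calc
    _ = 𝟙 _ ⊗≫ (𝟙_ C ◁ w ≫ η_ X Xᘁ ▷ ((Y ⊗ Yᘁ) ⊗ Y ⊗ Yᘁ)) ⊗≫ X ◁ B ▷ (Yᘁ ⊗ Y ⊗ Yᘁ) ⊗≫
        X ◁ Xᘁ ◁ (η_ Y Yᘁ)† ▷ (Y ⊗ Yᘁ) ⊗≫ 𝟙 _ := by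
      rw [link, cap, ← hB]; monoidal
    _ = 𝟙 _ ⊗≫ (η_ X Xᘁ ▷ 𝟙_ C ≫ (X ⊗ Xᘁ) ◁ w) ⊗≫ X ◁ B ▷ (Yᘁ ⊗ Y ⊗ Yᘁ) ⊗≫
        X ◁ Xᘁ ◁ (η_ Y Yᘁ)† ▷ (Y ⊗ Yᘁ) ⊗≫ 𝟙 _ := by
      rw [whisker_exchange]
    _ = η_ X Xᘁ ⊗≫ (X ⊗ Xᘁ) ◁ η_ Y Yᘁ ⊗≫
        X ◁ ((Xᘁ ⊗ Y) ◁ (ε_ Y Yᘁ)† ≫ B ▷ (Yᘁ ⊗ Y)) ▷ Yᘁ ⊗≫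
        X ◁ Xᘁ ◁ (η_ Y Yᘁ)† ▷ (Y ⊗ Yᘁ) ⊗≫ 𝟙 _ := by
      rw [hw]; monoidal
    _ = η_ X Xᘁ ⊗≫ (X ⊗ Xᘁ) ◁ η_ Y Yᘁ ⊗≫
        X ◁ (B ▷ 𝟙_ C ≫ (Xᘁ ⊗ Y) ◁ (ε_ Y Yᘁ)†) ▷ Yᘁ ⊗≫
        X ◁ Xᘁ ◁ (η_ Y Yᘁ)† ▷ (Y ⊗ Yᘁ) ⊗≫ 𝟙 _ := by
      rw [whisker_exchange]
    _ = η_ X Xᘁ ⊗≫ (X ⊗ Xᘁ) ◁ η_ Y Yᘁ ⊗≫ X ◁ B ▷ Yᘁ ⊗≫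
        (X ⊗ Xᘁ) ◁ (Y ◁ (ε_ Y Yᘁ)† ⊗≫ (η_ Y Yᘁ)† ▷ Y) ▷ Yᘁ ⊗≫ 𝟙 _ := by
      monoidal
    _ = _ := by
      rw [snake]; monoidal

/-- The Hilbert-Schmidt norm of the link diagram is the product of the loops of `X` and `Y`,
because the double braiding is unitary. -/
theorem rightTrace_link_comp_dagger (X Y : C) {t : ℂ}
    (h : η_ Y Yᘁ ≫ (η_ Y Yᘁ)† = t • 𝟙 (𝟙_ C)) :
    letI := ExactPairing.daggerSwap Y Yᘁ
    rightTrace (Y ⊗ Yᘁ) (Y ⊗ Yᘁ) (link X Y ≫ (link X Y)†) =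
      t • (η_ X Xᘁ ≫ (η_ X Xᘁ)†) := by
  -- With `Y` as dual of `Yᘁ`, the tensor product pairing makes `Y ⊗ Yᘁ` its own dual.
  let _ := ExactPairing.daggerSwap Y Yᘁ
  set k := η_ (Y ⊗ Yᘁ) (Y ⊗ Yᘁ) ≫ link X Y ▷ (Y ⊗ Yᘁ) with hk
  have hk1 : k = η_ X Xᘁ ⊗≫ (X ⊗ Xᘁ) ◁ η_ Y Yᘁ ⊗≫ X ◁ doubleBraiding Xᘁ Y ▷ Yᘁ ⊗≫ 𝟙 _ := by
    rw [← coevaluation_comp_link]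
    rfl
  have hk2 : k† = 𝟙 _ ⊗≫ X ◁ (doubleBraiding Xᘁ Y)† ▷ Yᘁ ⊗≫ (X ⊗ Xᘁ) ◁ (η_ Y Yᘁ)† ⊗≫
      (η_ X Xᘁ)† := by
    rw [hk1]
    simp [monoidalComp, dagger_comp]
  calc
    _ = k ≫ k† := by
      rw [hk, rightTrace, dagger_comp, dagger_whiskerRight, comp_whiskerRight]
      simp only [Category.assoc]
    _ = η_ X Xᘁ ⊗≫ (X ⊗ Xᘁ) ◁ η_ Y Yᘁ ⊗≫
        X ◁ (doubleBraiding Xᘁ Y ≫ (doubleBraiding Xᘁ Y)†) ▷ Yᘁ ⊗≫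
        (X ⊗ Xᘁ) ◁ (η_ Y Yᘁ)† ⊗≫ (η_ X Xᘁ)† := by
      rw [hk2, hk1]; monoidal
    _ = η_ X Xᘁ ⊗≫ (X ⊗ Xᘁ) ◁ (η_ Y Yᘁ ≫ (η_ Y Yᘁ)†) ⊗≫ (η_ X Xᘁ)† := by
      rw [doubleBraiding_comp_dagger]; monoidal
    _ = _ := by
      rw [h]
      simp [monoidalComp]

end Link

section Schur

variable {C : Type u} [Category.{v} C] [Preadditive C] [HasKernels C] {ι : Type*} {s : ι → C}

theorem IsSimpleObjects.hom_eq_zero (hs : IsSimpleObjects s) {i j : ι} (hij : i ≠ j)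
    (f : s i ⟶ s j) : f = 0 := by
  have := hs.simple i
  have := hs.simple j
  by_contra hf
  have := isIso_of_hom_simple hf
  exact hij (hs.eq_of_iso i j ⟨asIso f⟩)

end Schur

/-! ### Uniqueness of the quantum dimensions. -/

section QuantumDimension

variable {C : Type u} [Category.{v} C] [Preadditive C] [Linear ℂ C] [MonoidalCategory C]
  {ι : Type*} {s : ι → C}

/-- Let `M` be the largest ratio `d' c / d c`, attained at `m`. The fusion equation for `m ⊗ m` has
nonnegative coefficients, so `M ^ 2 ≤ M` and thus `M ≤ 1`. Exchanging `d` and `d'` gives uniqueness.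
-/
theorem IsQuantumDimension.le [Fintype ι] {d d' : ι → ℝ}
    (hd : IsQuantumDimension s d) (hd' : IsQuantumDimension s d') (a : ι) : d' a ≤ d a := by
  obtain ⟨m, -, hm⟩ := Finset.exists_max_image Finset.univ (fun c => d' c / d c) ⟨a, by simp⟩
  set M := d' m / d m
  have hle (c : ι) : d' c ≤ M * d c := (div_le_iff₀ (hd.pos c)).mp (hm c (by simp))
  have hMm : d' m = M * d m := (div_mul_cancel₀ _ (hd.pos m).ne').symm
  have hM0 : 0 < M := div_pos (hd'.pos m) (hd.pos m)
  have h : d' m * d' m ≤ M * (d m * d m) := by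
    rw [hd.mul_eq, hd'.mul_eq, Finset.mul_sum]
    refine Finset.sum_le_sum fun c _ => ?_
    rw [mul_left_comm]
    exact mul_le_mul_of_nonneg_left (hle c) (Nat.cast_nonneg _)
  have hM : M ≤ 1 := by
    rw [hMm] at h
    have h2 : M * (M * (d m * d m)) ≤ 1 * (M * (d m * d m)) := by linarith
    exact le_of_mul_le_mul_right h2 (mul_pos hM0 (mul_pos (hd.pos m) (hd.pos m)))
  exact (hle a).trans (mul_le_of_le_one_left (hd.pos a).le hM)

end QuantumDimension

/-! ### Decomposition into simple objects, and loops as quantum dimensions. -/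

section Decomposition

variable {C : Type u} [Category.{v} C] [Abelian C] [Linear ℂ C] [MonoidalCategory C]
  [MonoidalPreadditive C] [MonoidalLinear ℂ C] [RightRigidCategory C] {ι : Type*} {s : ι → C}

open DaggerCategory UnitaryFusionCategory

/-- Every object is a finite direct sum of the listed simple objects. -/
theorem IsSimpleObjects.exists_decomposition [FusionCategory C] (hs : IsSimpleObjects s) (X : C) :
    ∃ (n : ℕ) (j : Fin n → ι) (p : ∀ i, X ⟶ s (j i)) (q : ∀ i, s (j i) ⟶ X),
      (∀ i, q i ≫ p i = 𝟙 _) ∧ (∀ i k, i ≠ k → q i ≫ p k = 0) ∧ ∑ i, p i ≫ q i = 𝟙 X := by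
  obtain ⟨n, S, b, hS, ⟨hb⟩, ⟨φ⟩⟩ := FusionCategory.semisimple X
  choose j hj using fun i => hs.complete (S i) (hS i)
  let ψ (i : Fin n) : S i ≅ s (j i) := (hj i).some
  refine ⟨n, j, fun i => φ.hom ≫ b.π i ≫ (ψ i).hom, fun i => (ψ i).inv ≫ b.ι i ≫ φ.inv,
    fun i => by simp, fun i k hik => by simp [reassoc_of% bicone_ι_π_ne b hik], ?_⟩
  have := congrArg (fun f => φ.hom ≫ f ≫ φ.inv) (IsBilimit.total hb)
  simpa [Preadditive.comp_sum, Preadditive.sum_comp] using this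

theorem IsSimpleObjects.finrank_hom [FusionCategory C] [DecidableEq ι] (hs : IsSimpleObjects s)
    (i j : ι) : Module.finrank ℂ (s i ⟶ s j) = if i = j then 1 else 0 := by
  have := hs.simple i
  have := FusionCategory.finiteDimensional_hom (s i) (s i)
  split_ifs with h
  · subst h
    exact finrank_endomorphism_simple_eq_one ℂ (s i)
  · have : Subsingleton (s i ⟶ s j) :=
      ⟨fun f g => by rw [hs.hom_eq_zero h f, hs.hom_eq_zero h g]⟩
    exact Module.finrank_zero_of_subsingleton

theorem finrank_hom_eq_sum {n : ℕ} {X : C} {Y : Fin n → C} (p : ∀ i, X ⟶ Y i) (q : ∀ i, Y i ⟶ X)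
    (hqp : ∀ i, q i ≫ p i = 𝟙 _) (hne : ∀ i k, i ≠ k → q i ≫ p k = 0)
    (hpq : ∑ i, p i ≫ q i = 𝟙 X) [FusionCategory C] (Z : C) :
    Module.finrank ℂ (X ⟶ Z) = ∑ i, Module.finrank ℂ (Y i ⟶ Z) := by
  have (X Y : C) := FusionCategory.finiteDimensional_hom X Y
  rw [← Module.finrank_pi_fintype ℂ]
  refine LinearEquiv.finrank_eq
    { toFun := fun f i => q i ≫ f
      map_add' := fun f g => by ext; simp
      map_smul' := fun r f => by ext; simp
      invFun := fun f => ∑ i, p i ≫ f i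
      left_inv := fun f => ?_
      right_inv := fun f => ?_ }
  · simp [← Category.assoc, ← Preadditive.sum_comp, hpq]
  · ext i
    simp only [Preadditive.comp_sum]
    rw [Finset.sum_eq_single i]
    · simp [reassoc_of% hqp i]
    · intro k _ hk
      rw [reassoc_of% hne i k hk.symm, zero_comp]
    · simp

theorem rightTrace_comp_comm [UnitaryFusionCategory C] {X X' Y Y' : C} [ExactPairing X X']
    [ExactPairing Y Y'] [IsSpherical X X'] [IsSpherical Y Y'] (f : X ⟶ Y) (g : Y ⟶ X) :
    rightTrace X X' (f ≫ g) = rightTrace Y Y' (g ≫ f) := by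
  simpa using rightTrace_comp_dagger_eq f (g†)

/-- The trace as a linear map. -/
def rightTraceLinear [UnitaryFusionCategory C] (X X' : C) [ExactPairing X X'] :
    (X ⟶ X) →ₗ[ℂ] (𝟙_ C ⟶ 𝟙_ C) where
  toFun := rightTrace X X'
  map_add' f g := by simp [rightTrace]
  map_smul' r f := by simp [rightTrace]

theorem rightTrace_sum [UnitaryFusionCategory C] (X X' : C) [ExactPairing X X'] {κ : Type*}
    (t : Finset κ) (f : κ → (X ⟶ X)) :
    rightTrace X X' (∑ i ∈ t, f i) = ∑ i ∈ t, rightTrace X X' (f i) :=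
  map_sum (rightTraceLinear X X') f t

theorem rightTrace_smul [UnitaryFusionCategory C] (X X' : C) [ExactPairing X X'] (r : ℂ)
    (f : X ⟶ X) : rightTrace X X' (r • f) = r • rightTrace X X' f :=
  map_smul (rightTraceLinear X X') r f

theorem rightTrace_id [UnitaryFusionCategory C] (X X' : C) [ExactPairing X X'] :
    rightTrace X X' (𝟙 X) = η_ X X' ≫ (η_ X X')† := by
  simp [rightTrace]

/-- The loop of a simple object is a positive number. -/
theorem exists_pos_loop [UnitaryFusionCategory C] (X : C) [Simple X] :
    ∃ t : ℝ, 0 < t ∧ η_ X Xᘁ ≫ (η_ X Xᘁ)† = (t : ℂ) • 𝟙 (𝟙_ C) := by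
  obtain ⟨t, ht, h⟩ := exists_comp_dagger_eq_smul_id (η_ X Xᘁ)
  refine ⟨t, ht.lt_of_ne' ?_, h⟩
  rintro rfl
  -- A vanishing cup would make the identity of `X` zero by the zigzag identity.
  have h0 : η_ X Xᘁ = 0 := eq_zero_of_comp_dagger _ (by simp [h])
  have := ExactPairing.evaluation_coevaluation X Xᘁ
  rw [h0] at this
  refine id_nonzero X ?_
  have h1 := congrArg (fun f => (λ_ X).inv ≫ f ≫ (ρ_ X).hom) this
  simpa using h1.symm

/-- Cyclicity turns the trace of each projection `p i ≫ q i` into the loop of a simple summand, and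
the hom dimensions count the multiplicities. -/
theorem rightTrace_id_eq_sum [UnitaryFusionCategory C] [Fintype ι] (hs : IsSimpleObjects s)
    {δ : ι → ℝ} (hδ : ∀ a, η_ (s a) (s a)ᘁ ≫ (η_ (s a) (s a)ᘁ)† = (δ a : ℂ) • 𝟙 (𝟙_ C))
    (X X' : C) [ExactPairing X X'] [IsSpherical X X'] :
    rightTrace X X' (𝟙 X) =
      ((∑ c, (Module.finrank ℂ (X ⟶ s c) : ℝ) * δ c : ℝ) : ℂ) • 𝟙 (𝟙_ C) := by
  classical
  obtain ⟨n, j, p, q, hqp, hne, hpq⟩ := hs.exists_decomposition X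
  have hr (c : ι) : Module.finrank ℂ (X ⟶ s c) = ∑ i, if j i = c then 1 else 0 := by
    rw [finrank_hom_eq_sum p q hqp hne hpq]
    simp only [hs.finrank_hom]
  have hsum : ∑ c, (Module.finrank ℂ (X ⟶ s c) : ℝ) * δ c = ∑ i, δ (j i) := by
    simp only [hr, Nat.cast_sum, Finset.sum_mul]
    rw [Finset.sum_comm]
    simp
  rw [hsum, ← hpq, rightTrace_sum, Complex.ofReal_sum, Finset.sum_smul]
  refine Finset.sum_congr rfl fun i _ => ?_
  rw [rightTrace_comp_comm (X' := X') (Y' := (s (j i))ᘁ), hqp, rightTrace_id, hδ]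

/-- The quantum dimensions are the values of the loops. -/
theorem IsQuantumDimension.loop_eq [UnitaryFusionCategory C] [Fintype ι] (hs : IsSimpleObjects s)
    {d : ι → ℝ} (hd : IsQuantumDimension s d) (a : ι) :
    η_ (s a) (s a)ᘁ ≫ (η_ (s a) (s a)ᘁ)† = (d a : ℂ) • 𝟙 (𝟙_ C) := by
  have := hs.simple
  choose δ hpos hδ using fun a => exists_pos_loop (s a)
  -- The loop of `a ⊗ b` is evaluated both as nested loops and through its decomposition into
  -- simples.
  have hd' : IsQuantumDimension s δ := by
    refine ⟨hpos, fun a b => ?_⟩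
    have h1 := rightTrace_tensor_id (s a) (s a)ᘁ (s b) (s b)ᘁ (hδ b)
    rw [rightTrace_id_eq_sum hs hδ, hδ, smul_smul] at h1
    have h2 := smul_left_injective ℂ (id_unit_ne_zero (C := C)) h1
    rw [mul_comm]
    exact_mod_cast h2.symm
  rw [hδ, le_antisymm (hd.le hd' a) (hd'.le hd a)]

end Decomposition

/-! ### Orthogonal bases of vertices: completeness and Parseval. -/

section VertexBasis

variable {C : Type u} [Category.{v} C] [Abelian C] [Linear ℂ C] [MonoidalCategory C]
  [MonoidalPreadditive C] [MonoidalLinear ℂ C] [RightRigidCategory C] [UnitaryFusionCategory C]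
  {ι : Type*} {s : ι → C}

open DaggerCategory UnitaryFusionCategory

/-- A family of orthogonal bases of the spaces `c ⟶ X` resolves the identity of `X`. -/
theorem sum_dagger_comp_eq_id [Fintype ι] (hs : IsSimpleObjects s) {X : C} {κ : ι → Type*}
    [∀ c, Fintype (κ c)] (e : ∀ c, Module.Basis (κ c) ℂ (s c ⟶ X)) (n : ι → ℂ)
    (hn : ∀ c, n c ≠ 0) (h1 : ∀ c μ, e c μ ≫ (e c μ)† = n c • 𝟙 (s c))
    (h2 : ∀ c μ ν, μ ≠ ν → e c μ ≫ (e c ν)† = 0) :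
    ∑ c, ∑ μ, (n c)⁻¹ • ((e c μ)† ≫ e c μ) = 𝟙 X := by
  set g := ∑ c, ∑ μ, (n c)⁻¹ • ((e c μ)† ≫ e c μ) with hg
  have hbasis (c : ι) (ν : κ c) : e c ν ≫ g = e c ν := by
    rw [hg, Preadditive.comp_sum, Finset.sum_eq_single c, Preadditive.comp_sum,
      Finset.sum_eq_single ν]
    · rw [Linear.comp_smul, reassoc_of% h1, Linear.smul_comp, Category.id_comp, smul_smul,
        inv_mul_cancel₀ (hn c), one_smul]
    · intro μ _ hμ
      rw [Linear.comp_smul, ← Category.assoc, h2 c ν μ hμ.symm, zero_comp, smul_zero]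
    · simp
    · intro b _ hb
      rw [Preadditive.comp_sum]
      refine Finset.sum_eq_zero fun μ _ => ?_
      rw [Linear.comp_smul, ← Category.assoc, hs.hom_eq_zero hb.symm (e c ν ≫ (e b μ)†), zero_comp,
        smul_zero]
    · simp
  -- By semisimplicity, an endomorphism of `X` fixing all morphisms from simple objects is the
  -- identity.
  have hall (c : ι) (f : s c ⟶ X) : f ≫ g = f := by
    have : Linear.rightComp ℂ (s c) g = LinearMap.id := (e c).ext fun ν => hbasis c ν
    exact LinearMap.congr_fun this f
  obtain ⟨n, j, p, q, -, -, hpq⟩ := hs.exists_decomposition X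
  calc
    g = ∑ i, p i ≫ q i ≫ g := by
      conv_lhs => rw [← Category.id_comp g, ← hpq, Preadditive.sum_comp]
      simp only [Category.assoc]
    _ = 𝟙 X := by
      simp only [hall, hpq]

theorem comp_dagger_eq_sum_repr {X Y : C} {κ : Type*} [Fintype κ]
    (e : Module.Basis κ ℂ (X ⟶ Y)) (n : ℂ) (h1 : ∀ μ, e μ ≫ (e μ)† = n • 𝟙 X)
    (h2 : ∀ μ ν, μ ≠ ν → e μ ≫ (e ν)† = 0) (f : X ⟶ Y) :
    f ≫ f† = ((∑ μ, (Complex.normSq (e.repr f μ) : ℂ)) * n) • 𝟙 X := by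
  let D : (X ⟶ Y) →+ (Y ⟶ X) := AddMonoidHom.mk' dagger dagger_add
  have hD : f† = ∑ μ, (starRingEnd ℂ (e.repr f μ)) • (e μ)† := by
    conv_lhs => rw [← e.sum_repr f]
    refine (map_sum D _ _).trans (Finset.sum_congr rfl fun μ _ => ?_)
    exact dagger_smul _ _
  conv_lhs => rw [hD]
  conv_lhs => enter [1]; rw [← e.sum_repr f]
  rw [Preadditive.sum_comp, Finset.sum_mul, Finset.sum_smul]
  refine Finset.sum_congr rfl fun μ _ => ?_
  rw [Preadditive.comp_sum, Finset.sum_eq_single μ]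
  · rw [Linear.smul_comp, Linear.comp_smul, h1, smul_smul, smul_smul, ← Complex.mul_conj, mul_assoc]
  · intro ν _ hν
    rw [Linear.smul_comp, Linear.comp_smul, h2 μ ν hν.symm, smul_zero, smul_zero]
  · simp

end VertexBasis

/-! ### Matrix elements of the connected `S`-matrix. -/

section Main

variable {C : Type u} [Category.{v} C] [Abelian C] [Linear ℂ C] [MonoidalCategory C]
  [MonoidalPreadditive C] [MonoidalLinear ℂ C] [RightRigidCategory C] [BraidedCategory C]
  [UnitaryPremodularCategory C] {ι : Type*} [Fintype ι] {s : ι → C} {d : ι → ℝ}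
  {κ : ι → ι → Type*} [∀ c b, Fintype (κ c b)]

open DaggerCategory UnitaryFusionCategory

/-- The Hilbert-Schmidt norm of the link diagram in terms of its matrix elements between trivalent
vertices. -/
theorem sum_normSq_repr_link (hs : IsSimpleObjects s) (hd : IsQuantumDimension s d)
    (e : ∀ c b, Module.Basis (κ c b) ℂ (s c ⟶ s b ⊗ (s b)ᘁ)) (he : IsNormalizedVertexBasis s d e)
    (a b : ι) :
    ∑ c, ∑ β, ∑ α, Complex.normSq ((e c a).repr (e c b β ≫ link (s a) (s b)) α) * d c =
      d b ^ 2 := by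
  let _ := ExactPairing.daggerSwap (s b) (s b)ᘁ
  have := IsSpherical.daggerSwap (s b) (s b)ᘁ
  have hn (c b : ι) : Real.sqrt (d b * d b / d c) = d b / Real.sqrt (d c) := by
    rw [Real.sqrt_div (mul_self_nonneg _), Real.sqrt_mul_self (hd.pos b).le]
  have hc (c : ι) : 0 < Real.sqrt (d c) := Real.sqrt_pos.mpr (hd.pos c)
  have hnorm (c b : ι) : ((Real.sqrt (d b * d b / d c) : ℝ) : ℂ) ≠ 0 := by
    rw [hn]
    exact_mod_cast (div_pos (hd.pos b) (hc c)).ne'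
  have hid := sum_dagger_comp_eq_id hs (fun c => e c b) _ (fun c => hnorm c b)
    (fun c μ => he.1 c b μ) (fun c μ ν => he.2 c b μ ν)
  set l := link (s a) (s b)
  have htr := rightTrace_link_comp_dagger (s a) (s b) (hd.loop_eq hs b)
  rw [hd.loop_eq hs a, smul_smul, ← Category.id_comp (l ≫ l†), ← hid, Preadditive.sum_comp,
    rightTrace_sum] at htr
  have hterm (c : ι) (β : κ c b) : rightTrace (s b ⊗ (s b)ᘁ) (s b ⊗ (s b)ᘁ)
      ((((Real.sqrt (d b * d b / d c) : ℝ) : ℂ)⁻¹ • ((e c b β)† ≫ e c b β)) ≫ l ≫ l†) =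
      (((∑ α, Complex.normSq ((e c a).repr (e c b β ≫ l) α) * d c) * (d a / d b) : ℝ) : ℂ) •
        𝟙 (𝟙_ C) := by
    have hx := comp_dagger_eq_sum_repr (e c a) _ (he.1 c a) (he.2 c a) (e c b β ≫ l)
    rw [Linear.smul_comp, rightTrace_smul, Category.assoc,
      rightTrace_comp_comm (X' := s b ⊗ (s b)ᘁ) (Y' := (s c)ᘁ)]
    have hx' : (e c b β ≫ l ≫ l†) ≫ (e c b β)† = (e c b β ≫ l) ≫ (e c b β ≫ l)† := by
      rw [dagger_comp]; simp only [Category.assoc]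
    -- The factor `d a / d b` is the quotient of the vertex normalizations at `a` and `b`, in which
    -- `√(d c)` cancels; the remaining `d c` is the loop of `c`.
    rw [hx', hx, rightTrace_smul, rightTrace_id, hd.loop_eq hs c, smul_smul, smul_smul, hn, hn]
    congr 1
    have h1 := (hc c).ne'
    have h2 := (hd.pos b).ne'
    norm_cast
    rw [← Finset.sum_mul]
    field_simp
  have hsum : ∀ c, rightTrace (s b ⊗ (s b)ᘁ) (s b ⊗ (s b)ᘁ)
      ((∑ β, ((Real.sqrt (d b * d b / d c) : ℝ) : ℂ)⁻¹ • ((e c b β)† ≫ e c b β)) ≫ l ≫ l†) =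
      (((∑ β, ∑ α, Complex.normSq ((e c a).repr (e c b β ≫ l) α) * d c) * (d a / d b) : ℝ) : ℂ) •
        𝟙 (𝟙_ C) := by
    intro c
    rw [Preadditive.sum_comp, rightTrace_sum, Finset.sum_mul, Complex.ofReal_sum, Finset.sum_smul]
    exact Finset.sum_congr rfl fun β _ => hterm c β
  rw [Finset.sum_congr rfl fun c _ => hsum c, ← Finset.sum_smul, ← Complex.ofReal_sum,
    ← Finset.sum_mul, ← Complex.ofReal_mul] at htr
  have h := Complex.ofReal_injective (smul_left_injective ℂ (id_unit_ne_zero (C := C)) htr)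
  have ha := (hd.pos a).ne'
  have hb := (hd.pos b).ne'
  field_simp at h
  linarith

theorem connectedSMatrix_apply [DecidableEq ι] [∀ c b, DecidableEq (κ c b)]
    (e : ∀ c b, Module.Basis (κ c b) ℂ (s c ⟶ s b ⊗ (s b)ᘁ)) (c : ι)
    (i j : (b : ι) × κ c b) :
    connectedSMatrix s d e c i j = ((Real.sqrt (d c) / totalDim d * d i.1 : ℝ) : ℂ) *
      (e c i.1).repr (e c j.1 j.2 ≫ link (s i.1) (s j.1)) i.2 := by
  obtain ⟨b, β⟩ := j
  have h : ∑ x, (Pi.basis (e c) ⟨b, β⟩ x) ≫ link (s i.1) (s x) =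
      e c b β ≫ link (s i.1) (s b) := by
    rw [Finset.sum_eq_single b]
    · simp
    · intro x _ hx
      simp [Pi.single_eq_of_ne hx]
    · simp
  simp only [connectedSMatrix, LinearMap.toMatrix_apply, Pi.basis_repr, connectedS,
    LinearMap.pi_apply, LinearMap.smul_apply, LinearMap.sum_apply, LinearMap.comp_apply,
    LinearMap.proj_apply, Linear.rightComp_apply, map_smul, Finsupp.smul_apply, smul_eq_mul, h]

end Main

theorem mainTheorem4 {C : Type u} [Category.{v} C] [Abelian C] [Linear ℂ C]
    [MonoidalCategory C] [MonoidalPreadditive C] [MonoidalLinear ℂ C] [RightRigidCategory C]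
    [BraidedCategory C] [UnitaryPremodularCategory C]
    {ι : Type*} [Fintype ι] [DecidableEq ι] (s : ι → C) (hs : IsSimpleObjects s)
    (d : ι → ℝ) (hd : IsQuantumDimension s d)
    {κ : ι → ι → Type*} [∀ c b, Fintype (κ c b)] [∀ c b, DecidableEq (κ c b)]
    (e : ∀ c b, Module.Basis (κ c b) ℂ (s c ⟶ s b ⊗ (s b)ᘁ))
    (he : IsNormalizedVertexBasis s d e) :
    ∑ c, Matrix.trace ((connectedSMatrix s d e c).conjTranspose * connectedSMatrix s d e c) =
      ((totalDim d : ℝ) : ℂ) ^ 2 := by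
  have hD : 0 ≤ ∑ c, d c ^ 2 := Finset.sum_nonneg fun c _ => sq_nonneg _
  have hsq : totalDim d ^ 2 = ∑ c, d c ^ 2 := Real.sq_sqrt hD
  have key (c : ι) :
      Matrix.trace ((connectedSMatrix s d e c).conjTranspose * connectedSMatrix s d e c) =
      ((∑ b, ∑ a, d a ^ 2 / totalDim d ^ 2 * ∑ β, ∑ α,
        Complex.normSq ((e c a).repr (e c b β ≫ link (s a) (s b)) α) * d c : ℝ) : ℂ) := by
    have hentry (i j : (b : ι) × κ c b) :
        star (connectedSMatrix s d e c i j) * connectedSMatrix s d e c i j =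
        ((d i.1 ^ 2 / totalDim d ^ 2 * (Complex.normSq
          ((e c i.1).repr (e c j.1 j.2 ≫ link (s i.1) (s j.1)) i.2) * d c) : ℝ) : ℂ) := by
      rw [mul_comm, ← starRingEnd_apply, Complex.mul_conj, connectedSMatrix_apply,
        Complex.normSq_mul, Complex.normSq_ofReal]
      congr 1
      have := Real.mul_self_sqrt (hd.pos c).le
      rw [← this]
      simp only [Real.sqrt_mul_self (Real.sqrt_nonneg _)]
      ring
    simp only [Matrix.trace, Matrix.diag_apply, Matrix.mul_apply, Matrix.conjTranspose_apply,
      hentry]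
    rw [Complex.ofReal_sum, Fintype.sum_sigma]
    refine Finset.sum_congr rfl fun b _ => ?_
    simp only [Fintype.sum_sigma, Finset.mul_sum, Complex.ofReal_sum]
    rw [Finset.sum_comm]
  rw [Finset.sum_congr rfl fun c _ => key c, ← Complex.ofReal_sum, ← Complex.ofReal_pow]
  congr 1
  rw [Finset.sum_comm]
  have hinner (b : ι) : ∑ c, ∑ a, d a ^ 2 / totalDim d ^ 2 * ∑ β, ∑ α,
      Complex.normSq ((e c a).repr (e c b β ≫ link (s a) (s b)) α) * d c =
      ∑ a, d a ^ 2 / totalDim d ^ 2 * d b ^ 2 := by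
    rw [Finset.sum_comm]
    refine Finset.sum_congr rfl fun a _ => ?_
    rw [← Finset.mul_sum, sum_normSq_repr_link hs hd e he]
  simp only [hinner]
  simp only [← Finset.sum_mul, ← Finset.sum_div, ← Finset.mul_sum, ← hsq]
  -- If `𝒟 = 0`, both sides are zero since division by zero gives zero, so positivity of `𝒟` need
  -- not be proved.
  by_cases h : totalDim d = 0
  · simp [h]
  · field_simp
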